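/- Theorem. $G\mathsf{AC}^0 \not\subseteq [\text{Small} \cap \text{Hereditary}]_{\subseteq}$, i.e. there is a graph class in $G\mathsf{AC}^0$ that is not a subset of any small and hereditary graph class. This holds for directed graphs as well as for undirected graphs: there is such a class that consists only of undirected graphs without loops. Here a graph class is a set of finite unlabeled graphs (undirected graphs being directed graphs with symmetric edge relation). A graph class $\mathcal{C}$ is small if the number of unlabeled graphs on $n$ vertices in $\mathcal{C}$ is at most $n^{O(n)}$, and hereditary if it is closed under taking induced subgraphs; $[\mathbb{A}]_{\subseteq}$ is the set of all subsets of classes in $\mathbb{A}$. A labeling scheme is a pair $(F,c)$ with $F \subseteq \{0,1\}^* \times \{0,1\}^*$ and a positive integer $c$; a graph $G$ on $n$ vertices is in $\mathrm{gr}(F,c)$ if there is a labeling $\ell \colon V(G) \to \{0,1\}^{c \lceil \log_2 n \rceil}$ such that $(u,v) \in E(G) \Leftrightarrow (\ell(u),\ell(v)) \in F$ for all $u,v \in V(G)$. A language $L \subseteq \{0,1\}^*$ induces the relation $F_L = \{(x,y) : xy \in L,\ |x| = |y|\}$. The set $G\mathsf{AC}^0$ consists of all graph classes $\mathcal{C}$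 for which there are a language $L \in \mathsf{AC}^0$ and a positive integer $c$ with $\mathcal{C} \subseteq \mathrm{gr}(F_L,c)$. Finally, $\mathsf{AC}^0$ is the set of languages decided by logspace-uniform families of boolean circuits of constant depth and polynomial size with unbounded fan-in `and' and `or' gates and negation gates, where a family $(C_n)_n$ is logspace-uniform if a logspace transducer outputs a representation of $C_n$ on input $n$ in unary. -/

import Mathlib

/-! ### Finite graphs, graph classes and their properties -/

/-- A finite directed graph (loops allowed) with vertex set `{0, …, n - 1}`. An undirected graph is
the special case of a symmetric adjacency relation. -/
abbrev FinGraph : Type := Σ n : ℕ, Digraph (Fin n)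

/-- Isomorphism of finite graphs. -/
instance FinGraph.isoSetoid : Setoid FinGraph where
  r G H := Nonempty (G.2.Adj ≃r H.2.Adj)
  iseqv :=
    ⟨fun G => ⟨RelIso.refl G.2.Adj⟩, fun ⟨e⟩ => ⟨e.symm⟩, fun ⟨e⟩ ⟨f⟩ => ⟨e.trans f⟩⟩

/-- An unlabeled graph: an isomorphism class of finite graphs. -/
abbrev UnlabeledGraph : Type := Quotient FinGraph.isoSetoid

/-- The number of vertices of an unlabeled graph. -/
def UnlabeledGraph.order (g : UnlabeledGraph) : ℕ :=
  Quotient.lift (fun G : FinGraph => G.1)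
    (fun _ _ (h : Nonempty _) => h.elim fun e => by simpa using Fintype.card_congr e.toEquiv) g

/-- `g` is (isomorphic to) an induced subgraph of `h`. -/
def UnlabeledGraph.IsInducedSubgraph (g h : UnlabeledGraph) : Prop :=
  ∃ G H : FinGraph, ⟦G⟧ = g ∧ ⟦H⟧ = h ∧ Nonempty (G.2.Adj ↪r H.2.Adj)

/-- `g` is a simple undirected graph: its adjacency relation is symmetric and has no loops. -/
def UnlabeledGraph.IsUndirected (g : UnlabeledGraph) : Prop :=
  ∃ G : FinGraph, ⟦G⟧ = g ∧ (∀ u v, G.2.Adj u v → G.2.Adj v u) ∧ ∀ u, ¬ G.2.Adj u u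

/-- A graph class is a set of finite unlabeled graphs. -/
abbrev GraphClass : Type := Set UnlabeledGraph

namespace GraphClass

/-- All graphs of the class are undirected. -/
def IsUndirected (C : GraphClass) : Prop := ∀ g ∈ C, g.IsUndirected

/-- The class has at most `n ^ O(n)` (unlabeled) graphs on `n` vertices. -/
def IsSmall (C : GraphClass) : Prop :=
  ∃ c : ℕ, ∀ᶠ n : ℕ in Filter.atTop, {g ∈ C | g.order = n}.encard ≤ ((n ^ (c * n) : ℕ) : ℕ∞)

/-- The class is closed under taking induced subgraphs. -/
def IsHereditary (C : GraphClass) : Prop :=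
  ∀ g h : UnlabeledGraph, g.IsInducedSubgraph h → h ∈ C → g ∈ C

/-- The closure of a set of graph classes under subsets. -/
def subsetClosure (A : Set GraphClass) : Set GraphClass := {C | ∃ D ∈ A, C ⊆ D}

end GraphClass

/-! ### Labeling schemes -/

/-- A labeling scheme: a label decoder, which is a binary relation on words over `{0, 1}`, and a
positive integer, the label length. -/
structure LabelingScheme where
  decoder : Set (List Bool × List Bool)
  labelLength : ℕ+

/-- The class of graphs spanned by a labeling scheme with label length `c`: the graphs on `n` vertices
whose vertices can be labeled with words of length exactly `c * ⌈log₂ n⌉` such that the decoder, applied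
to the labels of two vertices, determines whether they are adjacent. -/
def LabelingScheme.gr (S : LabelingScheme) : GraphClass :=
  {g | ∃ G : FinGraph, ⟦G⟧ = g ∧ ∃ label : Fin G.1 → List Bool,
    (∀ v, (label v).length = S.labelLength * Nat.clog 2 G.1) ∧
    ∀ u v, G.2.Adj u v ↔ (label u, label v) ∈ S.decoder}

/-- The label decoder `F_L` induced by a language `L`. -/
def inducedDecoder (L : Language Bool) : Set (List Bool × List Bool) :=
  {p | p.1 ++ p.2 ∈ L ∧ p.1.length = p.2.length}

/-- `G·A`: the graph classes represented by a labeling scheme whose label decoder is induced by a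
language in `A`. -/
def GClasses (A : Set (Language Bool)) : Set GraphClass :=
  {C | ∃ L ∈ A, ∃ c : ℕ+, C ⊆ (LabelingScheme.mk (inducedDecoder L) c).gr}

/-! ### Boolean circuits -/

/-- A gate of a boolean circuit; `and` and `or` gates have unbounded fan-in. The arguments are indices of
wires: in a circuit with `n` inputs, wire `i < n` is the `i`-th input and wire `n + k` is the output of
the `k`-th gate. -/
inductive Gate where
  | neg (w : ℕ)
  | and (ws : List ℕ)
  | or (ws : List ℕ)

namespace Gate

/-- The wires that enter a gate. -/
def args : Gate → List ℕ
  | neg w => [w]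
  | and ws => ws
  | or ws => ws

/-- The value of a gate, given the list of the values of the previous wires. -/
def eval (vals : List Bool) : Gate → Bool
  | neg w => !(vals.getD w false)
  | and ws => ws.all fun w => vals.getD w false
  | or ws => ws.any fun w => vals.getD w false

/-- The depth of a gate, given the list of the depths of the previous wires. -/
def depth (depths : List ℕ) (g : Gate) : ℕ :=
  (g.args.map fun w => depths.getD w 0).foldr max 0 + 1

end Gate

/-- A boolean circuit with `n` inputs: a nonempty list of gates in topological order, the last of which
is the output gate. -/
structure Circuit (n : ℕ) where
  gates : List Gate
  ne_nil : gates ≠ []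
  wellFormed : ∀ (k : ℕ) (hk : k < gates.length), ∀ w ∈ gates[k].args, w < n + k

namespace Circuit

variable {n : ℕ}

/-- The number of gates. -/
def size (C : Circuit n) : ℕ := C.gates.length

/-- The values of all wires on input `x`. -/
def wireValues (C : Circuit n) (x : List Bool) : List Bool :=
  C.gates.foldl (fun vals g => vals ++ [g.eval vals]) x

/-- The output of the circuit on an input `x` of length `n`: the value of the last gate. -/
def eval (C : Circuit n) (x : List Bool) : Bool := (C.wireValues x).getLastD false

/-- The depths of all wires; input wires have depth `0`. -/
def wireDepths (C : Circuit n) : List ℕ :=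
  C.gates.foldl (fun depths g => depths ++ [g.depth depths]) (List.replicate n 0)

/-- The depth of the circuit: the largest number of gates on a path. -/
def depth (C : Circuit n) : ℕ := C.wireDepths.foldr max 0

end Circuit

/-- The alphabet in which circuits are written down. -/
inductive CircuitSymbol where
  | neg | and | or | wire | tally
  deriving DecidableEq

/-- The representation of a gate: the kind of gate, then the wires that enter it. Wire `w` is written as
the symbol `wire` followed by `w` in unary. (The number of wires of the circuits in question is
polynomial, hence so is the length of this representation.) -/
def Gate.encode (g : Gate) : List CircuitSymbol :=
  (match g with
    | .neg _ => CircuitSymbol.neg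
    | .and _ => CircuitSymbol.and
    | .or _ => CircuitSymbol.or) ::
  g.args.flatMap fun w => CircuitSymbol.wire :: List.replicate w CircuitSymbol.tally

/-- The representation of a circuit: the representations of its gates in order. -/
def Circuit.encode {n : ℕ} (C : Circuit n) : List CircuitSymbol := C.gates.flatMap Gate.encode

/-! ### Logspace transducers -/

/-- A cell of the read-only input tape, which holds the input word between two end markers. -/
inductive InputCell (α : Type) where
  | leftEnd
  | letter (a : α)
  | rightEnd

/-- The cell at position `p` of the input tape: the input word occupies the positions `1, …, |w|`. -/
def InputCell.read {α : Type} (w : List α) : ℕ → InputCell α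
  | 0 => leftEnd
  | p + 1 => match w[p]? with
    | some a => letter a
    | none => rightEnd

/-- The movement of a tape head. -/
inductive HeadMove where
  | left | stay | right

/-- The new position of a head on a one-way infinite tape; a head at the left end cannot move left. -/
def HeadMove.apply : HeadMove → ℕ → ℕ
  | left, p => p - 1
  | stay, p => p
  | right, p => p + 1

/-- A deterministic Turing machine with a two-way read-only input tape with letters from `α`, finitely
many one-way infinite work tapes, and a write-only output tape with letters from `β`. Given the state and
the scanned symbols, `step` is `none` if the machine halts, and otherwise yields the new state, the
movement of the input head, for every work tape the symbol to write and the movement of the head, and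
possibly a letter that is appended to the output. -/
structure Transducer (α β : Type) where
  State : Type
  Symbol : Type
  tapes : ℕ
  finiteState : Finite State
  finiteSymbol : Finite Symbol
  start : State
  blank : Symbol
  step : State → InputCell α → (Fin tapes → Symbol) →
    Option (State × HeadMove × (Fin tapes → Symbol × HeadMove) × Option β)

namespace Transducer

variable {α β : Type}

/-- A configuration of a transducer. -/
structure Config (M : Transducer α β) where
  state : M.State
  inputHead : ℕ
  work : Fin M.tapes → ℕ → M.Symbol
  workHead : Fin M.tapes → ℕ
  output : List β

/-- The initial configuration: blank work tapes, all heads at the left ends, no output. -/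
def init (M : Transducer α β) : M.Config where
  state := M.start
  inputHead := 0
  work := fun _ _ => M.blank
  workHead := fun _ => 0
  output := []

/-- One step of the computation on input `w`; `none` if the machine has halted. The input head never
moves beyond the right end marker. -/
def next (M : Transducer α β) (w : List α) (c : M.Config) : Option M.Config :=
  (M.step c.state (InputCell.read w c.inputHead) fun i => c.work i (c.workHead i)).map
    fun (q, inputMove, action, out) =>
      { state := q
        inputHead := min (inputMove.apply c.inputHead) (w.length + 1)
        work := fun i => Function.update (c.work i) (c.workHead i) (action i).1
        workHead := fun i => (action i).2.apply (c.workHead i)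
        output := c.output ++ out.toList }

/-- On input `w` the machine halts with output `v`. -/
def Outputs (M : Transducer α β) (w : List α) (v : List β) : Prop :=
  ∃ c : M.Config, StateTransition.Reaches (M.next w) M.init c ∧ M.next w c = none ∧ c.output = v

/-- On inputs of length `n` the heads of the work tapes visit `O(log n)` cells. -/
def IsLogspace (M : Transducer α β) : Prop :=
  ∃ a : ℕ, ∀ (w : List α) (c : M.Config), StateTransition.Reaches (M.next w) M.init c →
    ∀ i, c.workHead i ≤ a * Nat.log 2 w.length + a

end Transducer

/-! ### The class `AC⁰` -/

/-- The language `L` is decided by the circuit family `C`. -/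
def CircuitFamily.Decides (C : ∀ n, Circuit n) (L : Language Bool) : Prop :=
  ∀ x : List Bool, x ∈ L ↔ (C x.length).eval x = true

/-- A circuit family is logspace-uniform if a logspace transducer outputs the representation of its
`n`-th circuit on input `n` in unary, for all `n`. -/
def CircuitFamily.IsLogspaceUniform (C : ∀ n, Circuit n) : Prop :=
  ∃ M : Transducer Unit CircuitSymbol, M.IsLogspace ∧
    ∀ n, M.Outputs (List.replicate n ()) (C n).encode

/-- Logspace-uniform `AC⁰`: the languages decided by logspace-uniform circuit families of constant depth
and polynomial size over `and`, `or` (of unbounded fan-in) and negation gates. -/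
def ACZero : Set (Language Bool) :=
  {L | ∃ C : ∀ n, Circuit n, CircuitFamily.Decides C L ∧ CircuitFamily.IsLogspaceUniform C ∧
    (∃ d, ∀ n, (C n).depth ≤ d) ∧ ∃ k, ∀ n, (C n).size ≤ n ^ k + k}

/-! ### The least positive non-divisor -/

/-! Let `K` be the least non-divisor of `N`, and consider the words `x` of length `N` with `x i ∧ x
(N - 1 - i)` for some `i < K`. If `N = 2 * m` and the two halves are labels of `u` and `v`, this
compares the first `K` bits of one label with the last `K` bits of the other. With an adjacency row
at the front and a mirrored unit vector at the back, it decodes every graph on `k` vertices as soon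
as `k ≤ K` and `m` leaves room for both (`innerProductLabel_mem_decoder`).

`K` is unbounded, since it is at least `k` whenever `k!` divides `m`. So every undirected graph,
padded with isolated vertices to `2 ^ m` vertices, lies in the class, and a hereditary superclass
contains all undirected graphs (`GraphClass.IsHereditary.mk_ofRel_mem`). It is not small: on `2 * a`
vertices there are at least `2 ^ (a * a) / (2 * a)!` bipartite graphs, which outgrows every `n ^ (c
* n)`.

The circuits are an `or` of `K` binary `and` gates. The least non-divisor is chosen for uniformity:
it is at most `2 * log N + 2` (`Nat.leastNondivisor_le_log`), so a logspace machine can keep each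
candidate `L ≤ K` in unary between two marks and test `L ∣ N` by repeatedly walking its input head
`L` cells to the left. -/

/-- The least positive number that does not divide `N`; by convention `0` for `N = 0`. -/
noncomputable def Nat.leastNondivisor (N : ℕ) : ℕ := sInf {d | 0 < d ∧ ¬ d ∣ N}

namespace Nat

theorem leastNondivisor_zero : leastNondivisor 0 = 0 := by
  simp [leastNondivisor]

theorem leastNondivisor_spec {N : ℕ} (hN : N ≠ 0) :
    0 < leastNondivisor N ∧ ¬ leastNondivisor N ∣ N :=
  Nat.sInf_mem (s := {d | 0 < d ∧ ¬ d ∣ N})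
    ⟨N + 1, N.succ_pos, fun h => by have := Nat.le_of_dvd (Nat.pos_of_ne_zero hN) h; omega⟩

theorem leastNondivisor_le {N d : ℕ} (hd : 0 < d) (h : ¬ d ∣ N) : leastNondivisor N ≤ d :=
  Nat.sInf_le ⟨hd, h⟩

theorem dvd_of_lt_leastNondivisor {N d : ℕ} (hd : 0 < d) (h : d < leastNondivisor N) : d ∣ N := by
  by_contra hn
  exact (leastNondivisor_le hd hn).not_gt h

theorem leastNondivisor_le_succ (N : ℕ) : leastNondivisor N ≤ N + 1 := by
  rcases eq_or_ne N 0 with rfl | hN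
  · simp [leastNondivisor_zero]
  · exact leastNondivisor_le N.succ_pos fun h => by
      have := Nat.le_of_dvd (Nat.pos_of_ne_zero hN) h; omega

theorem le_leastNondivisor {N k : ℕ} (hN : N ≠ 0) (h : ∀ d, 0 < d → d < k → d ∣ N) :
    k ≤ leastNondivisor N := by
  by_contra hk
  have := leastNondivisor_spec hN
  exact this.2 (h _ this.1 (by omega))

/-- The central binomial coefficient divides every common multiple of `1, …, 2 * n`. -/
theorem centralBinom_dvd_of_forall_dvd {N n : ℕ} (h : ∀ d, 0 < d → d ≤ 2 * n → d ∣ N) :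
    centralBinom n ∣ N := by
  rcases n.eq_zero_or_pos with rfl | hn
  · simp
  rw [dvd_iff_prime_pow_dvd_dvd]
  intro p k hp hk
  -- A prime power dividing the central binomial coefficient is at most `2 * n`, hence one of the
  -- given divisors of `N`.
  refine h _ (pow_pos hp.pos k) ?_
  rw [hp.pow_dvd_iff_le_factorization (centralBinom_ne_zero n)] at hk
  exact (Nat.pow_le_pow_right hp.pos hk).trans (pow_factorization_choose_le (by omega))

theorem two_pow_le_centralBinom (n : ℕ) : 2 ^ n ≤ centralBinom n := by
  rcases n.eq_zero_or_pos with rfl | hn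
  · simp
  have h₁ := four_pow_le_two_mul_self_mul_centralBinom n hn
  have h₂ : 2 * n ≤ 2 ^ n := by
    obtain ⟨m, rfl⟩ : ∃ m, n = m + 1 := ⟨n - 1, by omega⟩
    have := Nat.lt_two_pow_self (n := m)
    rw [pow_succ]
    omega
  have h₃ : (4 : ℕ) ^ n = 2 ^ n * 2 ^ n := by rw [← mul_pow]; norm_num
  rw [h₃] at h₁
  exact Nat.le_of_mul_le_mul_left (h₁.trans (Nat.mul_le_mul_right _ h₂)) (by positivity)

/-- A Chebyshev-type estimate: if all numbers up to `2 * n` divide `N`, so does the central binomial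
coefficient, and then `2 ^ n ≤ N`. -/
theorem leastNondivisor_le_log (N : ℕ) : leastNondivisor N ≤ 2 * Nat.log 2 N + 2 := by
  rcases eq_or_ne N 0 with rfl | hN
  · simp [leastNondivisor_zero]
  by_contra! hlt
  set n := (leastNondivisor N - 1) / 2 with hn
  have hdvd : centralBinom n ∣ N := centralBinom_dvd_of_forall_dvd fun d hd hdn =>
    dvd_of_lt_leastNondivisor hd (by omega)
  have hle : 2 ^ n ≤ N :=
    (two_pow_le_centralBinom n).trans (Nat.le_of_dvd (Nat.pos_of_ne_zero hN) hdvd)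
  have := (Nat.le_log_iff_pow_le (by norm_num) hN).2 hle
  omega

end Nat

/-! ### Computations with bounded work tape heads -/

namespace Transducer

variable {α β : Type}

/-- A computation on input `w` in which the work tape heads never pass cell `s`. -/
def BoundedReaches (M : Transducer α β) (w : List α) (s : ℕ) : M.Config → M.Config → Prop :=
  Relation.ReflTransGen fun c c' => M.next w c = some c' ∧ ∀ i, c'.workHead i ≤ s

theorem BoundedReaches.reaches {M : Transducer α β} {w : List α} {s : ℕ} {c c' : M.Config}
    (h : M.BoundedReaches w s c c') : StateTransition.Reaches (M.next w) c c' :=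
  Relation.ReflTransGen.mono (fun _ _ h => h.1) _ _ h

/-- If a halting computation is bounded, so is every configuration that is reached. -/
theorem BoundedReaches.workHead_le {M : Transducer α β} {w : List α} {s : ℕ}
    {c d e : M.Config} (h : M.BoundedReaches w s c d) (hd : M.next w d = none)
    (hc : ∀ i, c.workHead i ≤ s) (he : StateTransition.Reaches (M.next w) c e) :
    ∀ i, e.workHead i ≤ s := by
  induction he using Relation.ReflTransGen.head_induction_on with
  | refl => exact hc
  | head h₁ _ ih =>
    -- The machine is deterministic: either the bounded computation has already halted, or its first
    -- step is the given one.
    rcases Relation.ReflTransGen.cases_head h with rfl | ⟨b, ⟨hb, hb'⟩, hbd⟩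
    · rw [hd] at h₁; cases h₁
    · rw [hb] at h₁
      obtain rfl := Option.some.inj h₁
      exact ih hbd hb'

end Transducer

/-! ### A transducer that writes down inner product circuits -/

namespace InnerProductTransducer

open CircuitSymbol (wire tally)
open HeadMove

/-- The states of the transducer. -/
inductive State where
  | start | seed
  | gateOpen | leftWireOpen | leftWire | skip | rightWire
  | cycle | count | rewind
  | growSeek | growMark | growReturn
  | orOpen | orWire | sweep | offset | shrink | shrinkReturn | inputReturn
  | halt
  deriving DecidableEq

instance : Finite State :=
  Finite.of_surjective (fun i : Fin 21 => State.ofNat i) fun q =>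
    ⟨⟨q.ctorIdx, by cases q <;> decide⟩, by cases q <;> rfl⟩

/-- The transition function. The work tape has marks at cell `0` and at a cell `L`. -/
def transition : State → InputCell Unit → Bool →
    Option (State × HeadMove × Bool × HeadMove × Option CircuitSymbol)
  | .start, _, _ => some (.seed, right, true, right, none)
  | .seed, .letter _, _ => some (.gateOpen, left, true, left, none)
  | .seed, _, b => some (.halt, stay, b, stay, some .or)
  | .gateOpen, _, b => some (.leftWireOpen, stay, b, stay, some .and)
  | .leftWireOpen, _, b => some (.leftWire, stay, b, right, some wire)
  | .leftWire, _, false => some (.leftWire, stay, false, right, some tally)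
  | .leftWire, _, true => some (.skip, right, true, left, some wire)
  | .skip, _, false => some (.skip, right, false, left, none)
  | .skip, _, true => some (.rightWire, right, true, stay, none)
  | .rightWire, .letter _, b => some (.rightWire, right, b, stay, some tally)
  | .rightWire, _, b => some (.cycle, left, b, stay, none)
  | .cycle, .letter _, b => some (.count, left, b, right, none)
  | .cycle, _, b => some (.growSeek, stay, b, right, none)
  | .count, _, true => some (.rewind, stay, true, left, none)
  | .count, .letter _, false => some (.count, left, false, right, none)
  | .count, _, false => some (.orOpen, stay, false, left, none)
  | .rewind, _, false => some (.rewind, stay, false, left, none)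
  | .rewind, _, true => some (.cycle, stay, true, stay, none)
  | .growSeek, _, false => some (.growSeek, stay, false, right, none)
  | .growSeek, _, true => some (.growMark, stay, false, right, none)
  | .growMark, _, _ => some (.growReturn, stay, true, left, none)
  | .growReturn, _, false => some (.growReturn, stay, false, left, none)
  | .growReturn, _, true => some (.gateOpen, stay, true, stay, none)
  | .orOpen, _, false => some (.orOpen, stay, false, left, none)
  | .orOpen, _, true => some (.orWire, stay, true, stay, some .or)
  | .orWire, _, b => some (.sweep, right, b, stay, some wire)
  | .sweep, .letter _, b => some (.sweep, right, b, stay, some tally)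
  | .sweep, _, b => some (.offset, stay, b, right, none)
  | .offset, _, false => some (.offset, stay, false, right, some tally)
  | .offset, _, true => some (.shrink, stay, false, left, none)
  | .shrink, _, true => some (.halt, stay, true, stay, none)
  | .shrink, _, false => some (.shrinkReturn, stay, true, left, none)
  | .shrinkReturn, _, false => some (.shrinkReturn, stay, false, left, none)
  | .shrinkReturn, _, true => some (.inputReturn, stay, true, stay, none)
  | .inputReturn, .leftEnd, b => some (.orWire, stay, b, stay, none)
  | .inputReturn, _, b => some (.inputReturn, left, b, stay, none)
  | .halt, _, _ => none

/-- The transducer. On input `1 ^ N` it writes, for `L = 1, 2, …`, the gate `and [L - 1, N - L]`, until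
`L` does not divide `N`, and then an `or` of all these gates. -/
def machine : Transducer Unit CircuitSymbol where
  State := State
  Symbol := Bool
  tapes := 1
  finiteState := inferInstance
  finiteSymbol := inferInstance
  start := .start
  blank := false
  step q a b := (transition q a (b 0)).map fun r => (r.1, r.2.1, fun _ => (r.2.2.1, r.2.2.2.1), r.2.2.2.2)

/-- The configuration with the given state, input head, work tape, work head and output. -/
def config (q : State) (p : ℕ) (t : ℕ → Bool) (h : ℕ) (o : List CircuitSymbol) : machine.Config where
  state := q
  inputHead := p
  work := fun _ => t
  workHead := fun _ => h
  output := o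

/-- The work tape with marks at the cells `0` and `L`. -/
def marks (L : ℕ) : ℕ → Bool := fun j => decide (j = 0 ∨ j = L)

theorem marks_zero (L : ℕ) : marks L 0 = true := by simp [marks]

theorem marks_self (L : ℕ) : marks L L = true := by simp [marks]

theorem marks_of_lt {L j : ℕ} (h : 0 < j) (hj : j < L) : marks L j = false := by
  simp [marks]; omega

theorem update_same (t : ℕ → Bool) {h : ℕ} {b : Bool} (hb : t h = b) : Function.update t h b = t := by
  subst hb; exact Function.update_eq_self h t

/-! ### Single steps, loops and phases of the computation -/

variable {N s : ℕ}

theorem read_zero : InputCell.read (List.replicate N ()) 0 = .leftEnd := rfl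

theorem read_letter {p : ℕ} (h : 0 < p) (hp : p ≤ N) :
    InputCell.read (List.replicate N ()) p = .letter () := by
  obtain ⟨p, rfl⟩ : ∃ r, p = r + 1 := ⟨p - 1, by omega⟩
  have : (List.replicate N ())[p]? = some () := by simp [List.getElem?_replicate]; omega
  simp [InputCell.read, this]

theorem read_rightEnd {p : ℕ} (hp : N < p) :
    InputCell.read (List.replicate N ()) p = .rightEnd := by
  obtain ⟨p, rfl⟩ : ∃ r, p = r + 1 := ⟨p - 1, by omega⟩
  have : (List.replicate N ())[p]? = none := by simp; omega
  simp [InputCell.read, this]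

/-- Computations of the transducer on input `1 ^ N`. -/
def Run (N s : ℕ) : machine.Config → machine.Config → Prop :=
  machine.BoundedReaches (List.replicate N ()) s

theorem Run.refl {c : machine.Config} : Run N s c c := Relation.ReflTransGen.refl

theorem Run.trans {c d e : machine.Config} (h : Run N s c d) (h' : Run N s d e) : Run N s c e :=
  Relation.ReflTransGen.trans h h'

/-- All components of the new configuration enter through equations, so that the target can be
written in simplified form. -/
theorem Run.step {q q' : State} {p p' : ℕ} {t t' : ℕ → Bool} {h h' : ℕ} {o o' : List CircuitSymbol}
    {a : InputCell Unit} {b b' : Bool} {mi mw : HeadMove} {e : Option CircuitSymbol}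
    (ha : InputCell.read (List.replicate N ()) p = a) (hb : t h = b)
    (hstep : transition q a b = some (q', mi, b', mw, e))
    (hp : min (mi.apply p) (N + 1) = p') (ht : Function.update t h b' = t') (hh : mw.apply h = h')
    (hs : h' ≤ s) (ho : o ++ e.toList = o') :
    Run N s (config q p t h o) (config q' p' t' h' o') := by
  refine Relation.ReflTransGen.single ⟨?_, fun _ => hs⟩
  subst ha hb hp ht hh ho
  simp only [Transducer.next, machine, config, hstep, Option.map_some, List.length_replicate]

/-- A state that moves the work head left until it scans a mark. -/
theorem Run.left_loop {q : State} (hq : ∀ a, transition q a false = some (q, stay, false, left, none))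
    {p L : ℕ} (hp : p ≤ N + 1) (h : ℕ) (hL : h < L) (hs : h ≤ s) (o : List CircuitSymbol) :
    Run N s (config q p (marks L) h o) (config q p (marks L) 0 o) := by
  induction h with
  | zero => exact .refl
  | succ h ih =>
    have hm : marks L (h + 1) = false := marks_of_lt h.succ_pos hL
    exact (Run.step rfl hm (hq _) (by simpa [HeadMove.apply] using hp) (update_same _ hm) rfl
      (h' := h) (by omega) (by simp)).trans (ih (by omega) (by omega))

/-- A state that moves the work head right until it scans a mark, with output on the way. -/
theorem Run.right_loop {q : State} {e : Option CircuitSymbol}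
    (hq : ∀ a, transition q a false = some (q, stay, false, right, e))
    {p L : ℕ} (hp : p ≤ N + 1) (hs : L ≤ s) (d h : ℕ) (h0 : 0 < h) (hd : h + d = L)
    (o : List CircuitSymbol) :
    Run N s (config q p (marks L) h o)
      (config q p (marks L) L (o ++ (List.replicate d e.toList).flatten)) := by
  induction d generalizing h o with
  | zero => obtain rfl : h = L := by omega
            simpa using Run.refl
  | succ d ih =>
    have hm : marks L h = false := marks_of_lt h0 (by omega)
    have := ih (h + 1) (by omega) (by omega) (o ++ e.toList)
    rw [List.append_assoc] at this
    rw [List.replicate_succ, List.flatten_cons]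
    exact (Run.step rfl hm (hq _) (by simpa [HeadMove.apply] using hp) (update_same _ hm) rfl
      (by simp [HeadMove.apply]; omega) rfl).trans this

/-- A state that moves the input head to the right end and writes a tally for every letter. -/
theorem Run.input_loop {q : State}
    (hq : ∀ b, transition q (.letter ()) b = some (q, right, b, stay, some tally))
    {t : ℕ → Bool} {h : ℕ} (hs : h ≤ s) (d p : ℕ) (h0 : 0 < p) (hd : p + d = N + 1)
    (o : List CircuitSymbol) :
    Run N s (config q p t h o) (config q (N + 1) t h (o ++ List.replicate d tally)) := by
  induction d generalizing p o with
  | zero => obtain rfl : p = N + 1 := by omega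
            simpa using Run.refl
  | succ d ih =>
    have := ih (p + 1) (by omega) (by omega) (o ++ [tally])
    rw [List.append_assoc] at this
    rw [List.replicate_succ]
    exact (Run.step (read_letter h0 (by omega)) rfl (hq _) (by simp [HeadMove.apply]; omega)
      (update_same _ rfl) rfl hs rfl).trans this

/-- The heads move in lockstep, which adds the work head position to the input head position. The
minimum is there because the input head stops at the right end marker, as happens when `L > N`. -/
theorem Run.skip_loop {L : ℕ} (o : List CircuitSymbol) (h p : ℕ) (hL : h < L) (hs : h ≤ s)
    (hp : p ≤ N + 1) :
    Run N s (config .skip p (marks L) h o) (config .skip (min (p + h) (N + 1)) (marks L) 0 o) := by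
  induction h generalizing p with
  | zero => simpa [hp] using Run.refl
  | succ h ih =>
    have hm : marks L (h + 1) = false := marks_of_lt h.succ_pos hL
    have := ih (min (p + 1) (N + 1)) (by omega) (by omega) (by omega)
    rw [show min (min (p + 1) (N + 1) + h) (N + 1) = min (p + (h + 1)) (N + 1) by omega] at this
    exact (Run.step rfl hm (p' := min (p + 1) (N + 1)) (o' := o)
      rfl rfl (update_same _ hm) (h' := h) rfl (by omega) (by simp)).trans this

theorem Run.inputReturn_loop {t : ℕ → Bool} {h : ℕ} (hs : h ≤ s) (o : List CircuitSymbol) (p : ℕ)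
    (hp : p ≤ N + 1) :
    Run N s (config .inputReturn p t h o) (config .inputReturn 0 t h o) := by
  induction p with
  | zero => exact .refl
  | succ p ih =>
    refine Run.trans ?_ (ih (by omega))
    rcases Nat.lt_or_ge N (p + 1) with h' | h'
    · exact Run.step (read_rightEnd h') rfl rfl (by simp [HeadMove.apply]; omega)
        (update_same _ rfl) rfl hs (by simp)
    · exact Run.step (read_letter p.succ_pos h') rfl rfl (by simp [HeadMove.apply]; omega)
        (update_same _ rfl) rfl hs (by simp)

/-- The transducer writes an `and` gate. -/
theorem Run.gate {L : ℕ} (hL : 0 < L) (hs : L ≤ s) (o : List CircuitSymbol) :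
    Run N s (config .gateOpen 0 (marks L) 0 o)
      (config .cycle N (marks L) 0 (o ++ (Gate.and [L - 1, N - L]).encode)) := by
  have e₁ : Run N s (config .gateOpen 0 (marks L) 0 o)
      (config .leftWireOpen 0 (marks L) 0 (o ++ [.and])) :=
    .step rfl rfl rfl (by simp [HeadMove.apply]) (update_same _ rfl) rfl (by simp) rfl
  have e₂ : Run N s (config .leftWireOpen 0 (marks L) 0 (o ++ [.and]))
      (config .leftWire 0 (marks L) 1 (o ++ [.and] ++ [wire])) :=
    .step rfl rfl rfl (by simp [HeadMove.apply]) (update_same _ rfl) rfl (by omega) rfl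
  have e₃ := Run.right_loop (N := N) (q := .leftWire) (e := some tally) (fun _ => rfl) (Nat.zero_le _)
    hs (L - 1) 1 one_pos (by omega) (o ++ [.and] ++ [wire])
  set o₁ := o ++ [.and] ++ [wire] ++ (List.replicate (L - 1) (some tally).toList).flatten with ho₁
  have e₄ : Run N s (config .leftWire 0 (marks L) L o₁)
      (config .skip (min 1 (N + 1)) (marks L) (L - 1) (o₁ ++ [wire])) :=
    .step rfl (marks_self L) rfl rfl (update_same _ (marks_self L)) rfl (by omega) rfl
  have e₅ := Run.skip_loop (N := N) (s := s) (L := L) (o₁ ++ [wire]) (L - 1) (min 1 (N + 1)) (by omega)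
    (by omega) (by omega)
  have e₆ : Run N s
      (config .skip (min (min 1 (N + 1) + (L - 1)) (N + 1)) (marks L) 0 (o₁ ++ [wire]))
      (config .rightWire (min (L + 1) (N + 1)) (marks L) 0 (o₁ ++ [wire])) :=
    .step rfl (marks_zero L) rfl (by simp only [HeadMove.apply]; omega)
      (update_same _ (marks_zero L)) rfl (by omega) (by simp)
  -- If `L > N`, the head is already at the right end and no tally is written, in agreement with the
  -- truncated difference `N - L`.
  have e₇ := Run.input_loop (N := N) (s := s) (q := .rightWire) (fun _ => rfl) (t := marks L) (h := 0)
    (by omega) (N - L) (min (L + 1) (N + 1)) (by omega) (by omega) (o₁ ++ [wire])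
  have e₈ : Run N s
      (config .rightWire (N + 1) (marks L) 0 (o₁ ++ [wire] ++ List.replicate (N - L) tally))
      (config .cycle N (marks L) 0 (o₁ ++ [wire] ++ List.replicate (N - L) tally)) :=
    .step (read_rightEnd (by omega)) rfl rfl (by simp [HeadMove.apply]) (update_same _ rfl) rfl
      (by omega) (by simp)
  have ho : o₁ ++ [wire] ++ List.replicate (N - L) tally
      = o ++ (Gate.and [L - 1, N - L]).encode := by
    simp [ho₁, Gate.encode, Gate.args]
  rw [← ho]
  exact (((((((e₁.trans e₂).trans e₃).trans e₄).trans e₅).trans e₆).trans e₇).trans e₈)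

theorem Run.count_loop {L : ℕ} (hs : L ≤ s) (o : List CircuitSymbol) (d p h : ℕ) (h0 : 0 < h)
    (hd : h + d ≤ L) (hp : d ≤ p) (hpN : p ≤ N) :
    Run N s (config .count p (marks L) h o) (config .count (p - d) (marks L) (h + d) o) := by
  induction d generalizing p h with
  | zero => exact .refl
  | succ d ih =>
    have hm : marks L h = false := marks_of_lt h0 (by omega)
    have := ih (p - 1) (h + 1) (by omega) (by omega) (by omega) (by omega)
    rw [show p - 1 - d = p - (d + 1) by omega, show h + 1 + d = h + (d + 1) by omega] at this
    exact (Run.step (read_letter (by omega) hpN) hm rfl (p' := p - 1) (o' := o)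
      (by simp [HeadMove.apply]; omega) (update_same _ hm) (h' := h + 1) rfl (by omega)
      (by simp)).trans this

theorem Run.cycle_start {L : ℕ} (hL : 0 < L) (hs : L ≤ s) (o : List CircuitSymbol) {p : ℕ} (hp : 0 < p)
    (hpN : p ≤ N) :
    Run N s (config .cycle p (marks L) 0 o) (config .count (p - 1) (marks L) 1 o) :=
  .step (read_letter hp hpN) rfl rfl (by simp [HeadMove.apply]; omega) (update_same _ rfl) rfl
    (by omega) (by simp)

/-- One walk of the work head from cell `0` to the mark at `L` takes the input head `L` cells to the
left. At the mark the machine ignores the input cell, so `p = L` still counts as a full round. -/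
theorem Run.cycle {L : ℕ} (hL : 0 < L) (hs : L ≤ s) (o : List CircuitSymbol) {p : ℕ} (hp : L ≤ p)
    (hpN : p ≤ N) :
    Run N s (config .cycle p (marks L) 0 o) (config .cycle (p - L) (marks L) 0 o) := by
  have e₁ := Run.cycle_start hL hs o (by omega) hpN
  have e₂ := Run.count_loop (N := N) hs o (L - 1) (p - 1) 1 one_pos (by omega) (by omega) (by omega)
  rw [show 1 + (L - 1) = L by omega, show p - 1 - (L - 1) = p - L by omega] at e₂
  have e₃ : Run N s (config .count (p - L) (marks L) L o) (config .rewind (p - L) (marks L) (L - 1) o) :=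
    .step rfl (marks_self L) rfl (by simp [HeadMove.apply]; omega) (update_same _ (marks_self L)) rfl
      (by omega) (by simp)
  have e₄ := Run.left_loop (N := N) (q := .rewind) (fun _ => rfl) (L := L) (p := p - L) (by omega)
    (L - 1) (by omega) (by omega : L - 1 ≤ s) o
  have e₅ : Run N s (config .rewind (p - L) (marks L) 0 o) (config .cycle (p - L) (marks L) 0 o) :=
    .step rfl (marks_zero L) rfl (by simp [HeadMove.apply]; omega) (update_same _ (marks_zero L)) rfl
      (by omega) (by simp)
  exact ((((e₁.trans e₂).trans e₃).trans e₄).trans e₅)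

/-- The transducer reduces the position of the input head modulo `L`. -/
theorem Run.cycle_loop {L : ℕ} (hL : 0 < L) (hs : L ≤ s) (o : List CircuitSymbol) (p : ℕ)
    (hpN : p ≤ N) :
    Run N s (config .cycle p (marks L) 0 o) (config .cycle (p % L) (marks L) 0 o) := by
  induction p using Nat.strong_induction_on with
  | _ p ih =>
    rcases Nat.lt_or_ge p L with h | h
    · rw [Nat.mod_eq_of_lt h]; exact .refl
    · rw [Nat.mod_eq_sub_mod h]
      exact (Run.cycle hL hs o h hpN).trans (ih _ (by omega) (by omega))

/-- If `L` divides `N`, then the transducer moves on to `L + 1`. -/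
theorem Run.grow {L : ℕ} (hL : 0 < L) (hs : L + 1 ≤ s) (hdvd : L ∣ N) (o : List CircuitSymbol) :
    Run N s (config .cycle N (marks L) 0 o) (config .gateOpen 0 (marks (L + 1)) 0 o) := by
  have e₁ := Run.cycle_loop hL (by omega : L ≤ s) o N le_rfl
  rw [Nat.mod_eq_zero_of_dvd hdvd] at e₁
  have e₂ : Run N s (config .cycle 0 (marks L) 0 o) (config .growSeek 0 (marks L) 1 o) :=
    .step rfl rfl rfl (by simp [HeadMove.apply]) (update_same _ rfl) rfl (by omega) (by simp)
  have e₃ := Run.right_loop (N := N) (q := .growSeek) (e := none) (fun _ => rfl) (Nat.zero_le _)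
    (by omega : L ≤ s) (L - 1) 1 one_pos (by omega) o
  have e₄ : Run N s (config .growSeek 0 (marks L) L (o ++ (List.replicate (L - 1) []).flatten))
      (config .growMark 0 (Function.update (marks L) L false) (L + 1) o) :=
    .step rfl (marks_self L) rfl (by simp [HeadMove.apply]) rfl rfl hs (by simp)
  have e₅ : Run N s (config .growMark 0 (Function.update (marks L) L false) (L + 1) o)
      (config .growReturn 0 (marks (L + 1)) L o) := by
    refine .step rfl rfl rfl (by simp [HeadMove.apply]) ?_ rfl (by omega) (by simp)
    funext j
    simp only [Function.update_apply, marks]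
    grind
  have e₆ := Run.left_loop (N := N) (q := .growReturn) (fun _ => rfl) (L := L + 1) (p := 0) (by omega)
    L (by omega) (by omega : L ≤ s) o
  have e₇ : Run N s (config .growReturn 0 (marks (L + 1)) 0 o)
      (config .gateOpen 0 (marks (L + 1)) 0 o) :=
    .step rfl (marks_zero _) rfl (by simp [HeadMove.apply]) (update_same _ (marks_zero _)) rfl
      (by omega) (by simp)
  exact ((((((e₁.trans e₂).trans e₃).trans e₄).trans e₅).trans e₆).trans e₇)

/-- If `L` does not divide `N`, then the transducer begins to write the `or` gate. -/
theorem Run.orOpen {L : ℕ} (hL : 0 < L) (hs : L ≤ s) (hdvd : ¬ L ∣ N) (o : List CircuitSymbol) :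
    Run N s (config .cycle N (marks L) 0 o) (config .orWire 0 (marks L) 0 (o ++ [.or])) := by
  have e₁ := Run.cycle_loop hL hs o N le_rfl
  have h0 : 0 < N % L := Nat.pos_of_ne_zero fun h => hdvd (Nat.dvd_of_mod_eq_zero h)
  have hlt := Nat.mod_lt N hL
  have hle := Nat.mod_le N L
  set r := N % L
  have e₂ := Run.cycle_start hL hs o h0 hle
  have e₃ := Run.count_loop hs o (r - 1) (r - 1) 1 one_pos (by omega) le_rfl (by omega : _ ≤ N)
  rw [show 1 + (r - 1) = r by omega, Nat.sub_self] at e₃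
  -- As `0 < r < L`, the input head reaches the left end while the work head is strictly between the
  -- marks; this is how non-divisibility is detected.
  have hm : marks L r = false := marks_of_lt h0 hlt
  have e₄ : Run N s (config .count 0 (marks L) r o) (config .orOpen 0 (marks L) (r - 1) o) :=
    .step read_zero hm rfl (by simp [HeadMove.apply]) (update_same _ hm) rfl (by omega) (by simp)
  have e₅ := Run.left_loop (N := N) (q := .orOpen) (fun _ => rfl) (L := L) (p := 0) (by omega)
    (r - 1) (by omega) (by omega : _ ≤ s) o
  have e₆ : Run N s (config .orOpen 0 (marks L) 0 o) (config .orWire 0 (marks L) 0 (o ++ [.or])) :=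
    .step rfl (marks_zero _) rfl (by simp [HeadMove.apply]) (update_same _ (marks_zero _)) rfl
      (by omega) (by simp)
  exact (((((e₁.trans e₂).trans e₃).trans e₄).trans e₅).trans e₆)

/-- The transducer writes one argument of the `or` gate. -/
theorem Run.orWire {l : ℕ} (hs : l + 1 ≤ s) (o : List CircuitSymbol) :
    Run N s (config .orWire 0 (marks (l + 1)) 0 o)
      (config .shrink (N + 1) (Function.update (marks (l + 1)) (l + 1) false) l
        (o ++ wire :: List.replicate (N + l) tally)) := by
  have e₁ : Run N s (config .orWire 0 (marks (l + 1)) 0 o)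
      (config .sweep 1 (marks (l + 1)) 0 (o ++ [wire])) :=
    .step rfl rfl rfl (by simp [HeadMove.apply]) (update_same _ rfl) rfl (by omega) rfl
  -- The wire index `N + l` is written in two pieces: `N` tallies from the input word, then `l` from
  -- the cells between the marks.
  have e₂ := Run.input_loop (N := N) (s := s) (q := .sweep) (fun _ => rfl) (t := marks (l + 1)) (h := 0)
    (by omega) N 1 one_pos (by omega) (o ++ [wire])
  set o₁ := o ++ [wire] ++ List.replicate N tally with ho₁
  have e₃ : Run N s (config .sweep (N + 1) (marks (l + 1)) 0 o₁)
      (config .offset (N + 1) (marks (l + 1)) 1 o₁) :=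
    .step (read_rightEnd (by omega)) rfl rfl (by simp [HeadMove.apply]) (update_same _ rfl) rfl
      (by omega) (by simp)
  have e₄ := Run.right_loop (N := N) (q := .offset) (e := some tally) (fun _ => rfl) le_rfl hs l 1
    one_pos (by omega) o₁
  have e₅ : Run N s
      (config .offset (N + 1) (marks (l + 1)) (l + 1)
        (o₁ ++ (List.replicate l (some tally).toList).flatten))
      (config .shrink (N + 1) (Function.update (marks (l + 1)) (l + 1) false) l
        (o ++ wire :: List.replicate (N + l) tally)) :=
    .step rfl (marks_self _) rfl (by simp [HeadMove.apply]) rfl rfl (by omega)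
      (by simp [ho₁])
  exact ((((e₁.trans e₂).trans e₃).trans e₄).trans e₅)

/-- The right mark has just been erased and is set again one cell further left, so the arguments of
the `or` gate come in decreasing order. -/
theorem Run.shrink {l : ℕ} (hs : l + 1 ≤ s) (o : List CircuitSymbol) :
    Run N s (config .shrink (N + 1) (Function.update (marks (l + 2)) (l + 2) false) (l + 1) o)
      (config .orWire 0 (marks (l + 1)) 0 o) := by
  have e₁ : Run N s
      (config .shrink (N + 1) (Function.update (marks (l + 2)) (l + 2) false) (l + 1) o)
      (config .shrinkReturn (N + 1) (marks (l + 1)) l o) := by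
    refine .step rfl (b := false) (by simp [marks]) rfl (by simp [HeadMove.apply]) ?_ rfl (by omega)
      (by simp)
    funext j
    simp only [Function.update_apply, marks]
    grind
  have e₂ := Run.left_loop (N := N) (q := .shrinkReturn) (fun _ => rfl) (L := l + 1) (p := N + 1) le_rfl
    l (by omega) (by omega : _ ≤ s) o
  have e₃ : Run N s (config .shrinkReturn (N + 1) (marks (l + 1)) 0 o)
      (config .inputReturn (N + 1) (marks (l + 1)) 0 o) :=
    .step rfl (marks_zero _) rfl (by simp [HeadMove.apply]) (update_same _ (marks_zero _)) rfl
      (by omega) (by simp)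
  have e₄ := Run.inputReturn_loop (N := N) (t := marks (l + 1)) (Nat.zero_le s) o (N + 1) le_rfl
  have e₅ : Run N s (config .inputReturn 0 (marks (l + 1)) 0 o)
      (config .orWire 0 (marks (l + 1)) 0 o) :=
    .step read_zero rfl rfl (by simp [HeadMove.apply]) (update_same _ rfl) rfl (by omega) (by simp)
  exact ((((e₁.trans e₂).trans e₃).trans e₄).trans e₅)

/-- The transducer writes the arguments of the `or` gate and halts. -/
theorem Run.orWires (l : ℕ) (hs : l + 1 ≤ s) (o : List CircuitSymbol) :
    ∃ p t h, Run N s (config .orWire 0 (marks (l + 1)) 0 o)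
      (config .halt p t h (o ++ (List.range (l + 1)).reverse.flatMap
        fun i => wire :: List.replicate (N + i) tally)) := by
  induction l generalizing o with
  | zero =>
    -- After the mark at cell `1` is erased, the head stands on the permanent mark at cell `0`,
    -- which is the signal to halt.
    refine ⟨_, _, _, (Run.orWire hs o).trans (.step (b := true) (a := .rightEnd)
      (read_rightEnd (by omega)) ?_ rfl rfl rfl rfl (by simp [HeadMove.apply]) ?_)⟩
    · simp [marks]
    · simp
  | succ l ih =>
    obtain ⟨p, t, h, hr⟩ := ih (by omega) (o ++ wire :: List.replicate (N + (l + 1)) tally)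
    refine ⟨p, t, h, ?_⟩
    have := ((Run.orWire hs o).trans (Run.shrink (by omega) _)).trans hr
    rw [List.append_assoc] at this
    rw [List.range_succ (n := l + 1)]
    simpa only [List.reverse_append, List.reverse_singleton, List.singleton_append,
      List.flatMap_cons] using this

/-- The gates of the circuit that the transducer writes down. -/
def gates (N K : ℕ) : List Gate :=
  ((List.range K).map fun i => Gate.and [i, N - (i + 1)]) ++
    [Gate.or ((List.range K).reverse.map (N + ·))]

/-- Induction on the distance `d` from `L` to `K`: every `L < K` divides `N` and the machine moves
on, while `L = K` does not and the `or` gate follows. -/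
theorem Run.gates_of_pos {K : ℕ} (hK : K = N.leastNondivisor) (hN : 0 < N) (hs : K ≤ s) (d L : ℕ)
    (hL : 0 < L) (hd : L + d = K) :
    ∃ p t h, Run N s
      (config .gateOpen 0 (marks L) 0
        (((List.range (L - 1)).map fun i => Gate.and [i, N - (i + 1)]).flatMap Gate.encode))
      (config .halt p t h ((gates N K).flatMap Gate.encode)) := by
  have hlist : ((List.range (L - 1)).map fun i => Gate.and [i, N - (i + 1)]).flatMap Gate.encode ++
      (Gate.and [L - 1, N - L]).encode =
      ((List.range L).map fun i => Gate.and [i, N - (i + 1)]).flatMap Gate.encode := by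
    obtain ⟨l, rfl⟩ : ∃ l, L = l + 1 := ⟨L - 1, by omega⟩
    simp [List.range_succ]
  induction d generalizing L with
  | zero =>
    obtain rfl : L = K := by omega
    have e₁ := Run.gate (N := N) hL hs
      (((List.range (L - 1)).map fun i => Gate.and [i, N - (i + 1)]).flatMap Gate.encode)
    rw [hlist] at e₁
    have e₂ := e₁.trans (Run.orOpen hL hs (hK ▸ (Nat.leastNondivisor_spec hN.ne').2) _)
    obtain ⟨l, rfl⟩ : ∃ l, L = l + 1 := ⟨L - 1, by omega⟩
    obtain ⟨p, t, h, e₃⟩ := Run.orWires (N := N) l hs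
      (((List.range (l + 1)).map fun i => Gate.and [i, N - (i + 1)]).flatMap Gate.encode ++ [.or])
    refine ⟨p, t, h, ?_⟩
    convert e₂.trans e₃ using 1
    simp [gates, Gate.encode, Gate.args, List.flatMap_map, List.flatMap_append, -List.map_reverse]
  | succ d ih =>
    have e₁ := Run.gate (N := N) hL (by omega : L ≤ s)
      (((List.range (L - 1)).map fun i => Gate.and [i, N - (i + 1)]).flatMap Gate.encode)
    rw [hlist] at e₁
    obtain ⟨p, t, h, e₂⟩ := ih (L + 1) (by omega) (by omega) (by simp [List.range_succ])
    exact ⟨p, t, h, (e₁.trans (Run.grow hL (by omega)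
      (Nat.dvd_of_lt_leastNondivisor hL (by omega)) _)).trans e₂⟩

/-- The computation of the transducer on input `1 ^ N`. -/
theorem Run.gates (N : ℕ) (hs : N.leastNondivisor + 1 ≤ s) :
    ∃ p t h, Run N s machine.init
      (config .halt p t h ((gates N N.leastNondivisor).flatMap Gate.encode)) := by
  have hinit : machine.init = config .start 0 (fun _ => false) 0 [] := rfl
  rw [hinit]
  have e₁ : Run N s (config .start 0 (fun _ => false) 0 [])
      (config .seed 1 (Function.update (fun _ => false) 0 true) 1 []) :=
    .step rfl rfl rfl (by simp [HeadMove.apply]) rfl rfl (by omega) rfl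
  rcases N.eq_zero_or_pos with rfl | hN
  -- For `N = 0` the circuit is a single empty `or` gate. The start already visits cell `1` although
  -- `K = 0`, whence the bound `K + 1` on the work head.
  · refine ⟨_, _, _, e₁.trans (.step (read_rightEnd (by omega)) rfl rfl rfl rfl rfl
      (by simp [HeadMove.apply]; omega) ?_)⟩
    simp [InnerProductTransducer.gates, Nat.leastNondivisor_zero, Gate.encode, Gate.args]
  · have e₂ : Run N s (config .seed 1 (Function.update (fun _ => false) 0 true) 1 [])
        (config .gateOpen 0 (marks 1) 0 []) := by
      refine .step (read_letter one_pos hN) rfl rfl (by simp [HeadMove.apply]) ?_ rfl (by omega) rfl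
      funext j
      simp only [Function.update_apply, marks]
      grind
    have hK := (Nat.leastNondivisor_spec hN.ne').1
    obtain ⟨p, t, h, e₃⟩ := Run.gates_of_pos (s := s) rfl hN (by omega) (N.leastNondivisor - 1) 1 one_pos
      (by omega)
    exact ⟨p, t, h, (e₁.trans e₂).trans e₃⟩

theorem machine_outputs (N : ℕ) :
    machine.Outputs (List.replicate N ()) ((gates N N.leastNondivisor).flatMap Gate.encode) := by
  obtain ⟨p, t, h, e⟩ := Run.gates N le_rfl
  exact ⟨_, e.reaches, rfl, rfl⟩

theorem machine_isLogspace : machine.IsLogspace := by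
  refine ⟨3, fun w c hc i => ?_⟩
  obtain ⟨N, rfl⟩ : ∃ N, w = List.replicate N () :=
    ⟨w.length, List.eq_replicate_iff.2 ⟨rfl, fun _ _ => rfl⟩⟩
  obtain ⟨p, t, h, e⟩ := Run.gates N le_rfl
  have := e.workHead_le rfl (fun _ => Nat.zero_le _) hc i
  have := N.leastNondivisor_le_log
  rw [List.length_replicate]
  omega

end InnerProductTransducer

/-! ### The inner product circuits -/

namespace List

variable {γ δ : Type*}

/-- If no gate looks at the values of other gates, the gates can be evaluated independently. -/
theorem foldl_append_singleton (f : List δ → γ → δ) (gs : List γ) (x : List δ)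
    (h : ∀ g ∈ gs, ∀ y, f (x ++ y) g = f x g) :
    gs.foldl (fun vals g => vals ++ [f vals g]) x = x ++ gs.map (f x) := by
  induction gs generalizing x with
  | nil => simp
  | cons g gs ih =>
    have h' : ∀ g' ∈ gs, f (x ++ [f x g]) g' = f x g' := fun g' hg' => h g' (by simp [hg']) _
    rw [foldl_cons, ih _ fun g' hg' y => by rw [append_assoc, h g' (by simp [hg']), h' g' hg'],
      map_cons, append_assoc, singleton_append, map_congr_left h']

theorem foldr_max_le {l : List ℕ} {d : ℕ} (h : ∀ x ∈ l, x ≤ d) : l.foldr max 0 ≤ d := by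
  induction l with
  | nil => simp
  | cons a l ih =>
    simp only [foldr_cons, max_le_iff]
    exact ⟨h a (by simp), ih fun x hx => h x (by simp [hx])⟩

end List

/-! ### Comparison of the least non-divisor with the number itself -/

namespace Nat

theorem leastNondivisor_one : leastNondivisor 1 = 2 :=
  le_antisymm (leastNondivisor_le (by norm_num) (by norm_num))
    (le_leastNondivisor (by norm_num) fun d h h' => by interval_cases d; norm_num)

theorem leastNondivisor_two : leastNondivisor 2 = 3 :=
  le_antisymm (leastNondivisor_le (by norm_num) (by norm_num))
    (le_leastNondivisor (by norm_num) fun d h h' => by interval_cases d <;> norm_num)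

theorem leastNondivisor_le_self {N : ℕ} (h₁ : N ≠ 1) (h₂ : N ≠ 2) : leastNondivisor N ≤ N := by
  rcases eq_or_ne N 0 with rfl | h₀
  · simp [leastNondivisor_zero]
  refine (leastNondivisor_le (d := N - 1) (by omega) fun h => ?_).trans (N.sub_le 1)
  have : N - 1 ∣ 1 := by
    have := Nat.dvd_sub h (dvd_refl (N - 1))
    rwa [show N - (N - 1) = 1 by omega] at this
  have := Nat.le_of_dvd one_pos this
  omega

end Nat

open InnerProductTransducer (gates)

/-- The circuit with `N` inputs that computes `⋁ i < K, x i ∧ x (N - 1 - i)`, where `K` is the least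
non-divisor of `N`. -/
noncomputable def innerProductCircuit (N : ℕ) : Circuit N where
  gates := gates N N.leastNondivisor
  ne_nil := by simp [gates]
  wellFormed := by
    intro k hk w hw
    have hk' : k < N.leastNondivisor + 1 := by simpa [gates] using hk
    rcases Nat.lt_or_ge k N.leastNondivisor with h | h
    -- Positivity of `N` is all that is needed for `k < N + k`. For `N = 1` and `N = 2`, where `K >
    -- N`, some `and` gates read earlier gates instead of inputs.
    · have hN : N ≠ 0 := by rintro rfl; simp [Nat.leastNondivisor_zero] at h
      rw [show (gates N N.leastNondivisor)[k] = Gate.and [k, N - (k + 1)] by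
        simp [gates, h]] at hw
      simp only [Gate.args, List.mem_cons, List.not_mem_nil, or_false] at hw
      omega
    · obtain rfl : k = N.leastNondivisor := by omega
      rw [show (gates N N.leastNondivisor)[N.leastNondivisor] =
        Gate.or ((List.range N.leastNondivisor).reverse.map (N + ·)) by
          simp [gates]] at hw
      simp only [Gate.args, List.mem_map, List.mem_reverse, List.mem_range] at hw
      omega

namespace innerProductCircuit

theorem size_eq (N : ℕ) : (innerProductCircuit N).size = N.leastNondivisor + 1 := by
  simp [Circuit.size, innerProductCircuit, gates]

/-- The gates, evaluated one after the other by `f`. -/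
theorem foldl_gates {δ : Type*} (f : List δ → Gate → δ) {N K : ℕ} (x : List δ)
    (h : ∀ i < K, ∀ y, f (x ++ y) (.and [i, N - (i + 1)]) = f x (.and [i, N - (i + 1)])) :
    (gates N K).foldl (fun vals g => vals ++ [f vals g]) x =
      let y := x ++ (List.range K).map fun i => f x (.and [i, N - (i + 1)])
      y ++ [f y (.or ((List.range K).reverse.map (N + ·)))] := by
  rw [gates, List.foldl_append, List.foldl_append_singleton f _ x (by simpa using h)]
  simp [Function.comp_def]

theorem getD_map_range {δ : Type*} {x : List δ} {N K i : ℕ} (hx : x.length = N) (hi : i < K)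
    (f : ℕ → δ) (d : δ) : (x ++ (List.range K).map f).getD (N + i) d = f i := by
  subst hx
  simp [List.getD_eq_getElem?_getD, hi]

/-- The assumption `K ≤ N` makes all arguments of the `and` gates input wires, so that these gates
do not read each other. -/
theorem eval_eq_true_iff {N : ℕ} (hK : N.leastNondivisor ≤ N) {x : List Bool} (hx : x.length = N) :
    (innerProductCircuit N).eval x = true ↔
      ∃ i < N.leastNondivisor, x.getD i false = true ∧ x.getD (N - (i + 1)) false = true := by
  rw [Circuit.eval, Circuit.wireValues, innerProductCircuit, foldl_gates (fun v g => g.eval v)]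
  · simp only [Gate.eval]
    rw [List.getLastD_concat, List.any_eq_true]
    simp only [List.mem_map, List.mem_reverse, List.mem_range, exists_exists_and_eq_and]
    refine exists_congr fun i => and_congr_right fun hi => ?_
    rw [getD_map_range hx hi]
    simp
  · intro i hi y
    simp only [Gate.eval, List.all_cons, List.all_nil]
    rw [List.getD_append _ _ _ _ (by omega), List.getD_append _ _ _ _ (by omega)]

theorem depth_le (N : ℕ) : (innerProductCircuit N).depth ≤ 4 := by
  -- The cases `1` and `2`, where `and` gates are nested, are computed directly. In all others the
  -- `and` gates have depth `1`; the bound `4` is generous.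
  rcases eq_or_ne N 1 with rfl | h₁
  · simp only [Circuit.depth, Circuit.wireDepths, innerProductCircuit, Nat.leastNondivisor_one]
    decide
  rcases eq_or_ne N 2 with rfl | h₂
  · simp only [Circuit.depth, Circuit.wireDepths, innerProductCircuit, Nat.leastNondivisor_two]
    decide
  have hK := Nat.leastNondivisor_le_self h₁ h₂
  have hand : ∀ i, (Gate.and [i, N - (i + 1)]).depth (List.replicate N 0) = 1 := by
    intro i
    simp only [Gate.depth, Gate.args, List.map_cons, List.map_nil, List.foldr_cons, List.foldr_nil,
      List.getD_eq_getElem?_getD, List.getElem?_replicate]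
    split_ifs <;> simp
  rw [Circuit.depth, Circuit.wireDepths, innerProductCircuit, foldl_gates (fun v g => g.depth v)]
  · refine List.foldr_max_le fun d hd => ?_
    simp only [hand, List.mem_append, List.mem_replicate, List.mem_map, List.mem_singleton] at hd
    rcases hd with (⟨-, rfl⟩ | ⟨i, -, rfl⟩) | rfl
    · omega
    · omega
    · refine Nat.succ_le_succ (List.foldr_max_le fun d hd => ?_)
      simp only [Gate.args, List.mem_map, List.mem_reverse, List.mem_range,
        exists_exists_and_eq_and] at hd
      obtain ⟨i, hi, rfl⟩ := hd
      rw [getD_map_range (List.length_replicate ..) hi]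
      omega
  · intro i hi y
    simp only [Gate.depth, Gate.args, List.map_cons, List.map_nil]
    rw [List.getD_append _ _ _ _ (by simp; omega), List.getD_append _ _ _ _ (by simp; omega)]

theorem isLogspaceUniform : CircuitFamily.IsLogspaceUniform innerProductCircuit :=
  ⟨InnerProductTransducer.machine, InnerProductTransducer.machine_isLogspace,
    InnerProductTransducer.machine_outputs⟩

end innerProductCircuit

/-- The language decided by the inner product circuits. -/
def innerProductLanguage : Language Bool :=
  {x | (innerProductCircuit x.length).eval x = true}

theorem innerProductLanguage_mem_ACZero : innerProductLanguage ∈ ACZero := by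
  refine ⟨innerProductCircuit, fun x => Iff.rfl, innerProductCircuit.isLogspaceUniform,
    ⟨4, innerProductCircuit.depth_le⟩, 2, fun n => ?_⟩
  rw [innerProductCircuit.size_eq]
  have := n.leastNondivisor_le_succ
  nlinarith

/-! ### Graphs that are spanned by the inner product labeling scheme -/

/-- The graph on `n` vertices with adjacency relation `r`. -/
def FinGraph.ofRel (r : ℕ → ℕ → Prop) (n : ℕ) : FinGraph := ⟨n, ⟨fun u v => r u v⟩⟩

open FinGraph (ofRel)

open Classical in
/-- The label of a vertex `u` of a graph on `k` vertices with adjacency relation `r`: its adjacency row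
in the first `k` bits, and the indicator of `u` in the last `k` bits, in reverse order. -/
noncomputable def innerProductLabel (r : ℕ → ℕ → Prop) (k m u : ℕ) : List Bool :=
  List.ofFn fun j : Fin m => decide (r u j ∨ j + u + 1 = m ∧ u < k)

theorem innerProductLabel_getD {r : ℕ → ℕ → Prop} {k m u j : ℕ} (hj : j < m) :
    (innerProductLabel r k m u).getD j false = true ↔ r u j ∨ j + u + 1 = m ∧ u < k := by
  simp [innerProductLabel, List.getD_eq_getElem?_getD, hj]

/-- Bit `i` of the first label says that `u` is adjacent to `i`, and its mirror bit in the second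
label says that `v = i`. The bound `k ≤ K` covers all columns, and `K + k ≤ m` keeps indicator bits
out of the first `K` positions and row bits out of the last `K`. Vertices from `k` on get the zero
label and are isolated. -/
theorem innerProductLabel_mem_decoder {r : ℕ → ℕ → Prop} {k m : ℕ}
    (hr : ∀ u v, r u v → u < k ∧ v < k) (hkK : k ≤ (2 * m).leastNondivisor)
    (hKm : (2 * m).leastNondivisor + k ≤ m) (u v : ℕ) :
    (innerProductLabel r k m u, innerProductLabel r k m v) ∈ inducedDecoder innerProductLanguage ↔
      r u v := by
  have hlen : ∀ u, (innerProductLabel r k m u).length = m := fun u => by simp [innerProductLabel]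
  have hw : (innerProductLabel r k m u ++ innerProductLabel r k m v).length = 2 * m := by
    rw [List.length_append, hlen, hlen]; omega
  have hmem : innerProductLabel r k m u ++ innerProductLabel r k m v ∈ innerProductLanguage ↔
      (innerProductCircuit (2 * m)).eval
        (innerProductLabel r k m u ++ innerProductLabel r k m v) = true := by
    rw [← hw]; exact Iff.rfl
  simp only [inducedDecoder, Set.mem_ofPred_eq, hlen, and_true]
  rw [hmem, innerProductCircuit.eval_eq_true_iff (by omega) hw]
  have key : ∀ i < (2 * m).leastNondivisor,
      ((innerProductLabel r k m u ++ innerProductLabel r k m v).getD i false = true ∧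
        (innerProductLabel r k m u ++ innerProductLabel r k m v).getD (2 * m - (i + 1)) false = true ↔
      r u i ∧ v = i) := by
    intro i hi
    rw [List.getD_append _ _ _ _ (by rw [hlen]; omega),
      List.getD_append_right _ _ _ _ (by rw [hlen]; omega), hlen,
      innerProductLabel_getD (by omega), innerProductLabel_getD (by omega)]
    constructor
    · rintro ⟨h₁ | h₁, h₂ | h₂⟩
      · have := hr _ _ h₂; omega
      · exact ⟨h₁, by omega⟩
      · omega
      · omega
    · rintro ⟨h, rfl⟩
      have := hr _ _ h
      exact ⟨.inl h, .inr (by omega)⟩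
  constructor
  · rintro ⟨i, hi, h⟩
    obtain ⟨h, rfl⟩ := (key i hi).1 h
    exact h
  · intro h
    have := hr _ _ h
    exact ⟨v, by omega, (key v (by omega)).2 ⟨h, rfl⟩⟩

/-- The undirected graphs spanned by the inner product labeling scheme. -/
def innerProductClass : GraphClass :=
  {g ∈ (LabelingScheme.mk (inducedDecoder innerProductLanguage) 1).gr | g.IsUndirected}

theorem innerProductClass_mem : innerProductClass ∈ {C ∈ GClasses ACZero | C.IsUndirected} :=
  ⟨⟨_, innerProductLanguage_mem_ACZero, 1, fun _ hg => hg.1⟩, fun _ hg => hg.2⟩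

/-- Every hereditary class that contains `innerProductClass` contains all undirected graphs. -/
theorem GraphClass.IsHereditary.mk_ofRel_mem {D : GraphClass} (hD : D.IsHereditary)
    (hsub : innerProductClass ⊆ D) {r : ℕ → ℕ → Prop} {k : ℕ} (hk : 0 < k)
    (hr : ∀ u v, r u v → u < k ∧ v < k) (hsymm : ∀ u v, r u v → r v u) (hirr : ∀ u, ¬ r u u) :
    (⟦ofRel r k⟧ : UnlabeledGraph) ∈ D := by
  -- Divisibility by `k!` makes the least non-divisor of `2 * m` at least `k`; the bound `4 * k ≤ m`
  -- keeps it at most `m - k`.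
  obtain ⟨m, hm, hdvd⟩ : ∃ m, 4 * k ≤ m ∧ k.factorial ∣ m :=
    ⟨4 * k * k.factorial, Nat.le_mul_of_pos_right _ k.factorial_pos, Dvd.intro_left _ rfl⟩
  have hkK : k ≤ (2 * m).leastNondivisor := Nat.le_leastNondivisor (by omega) fun d hd hdk =>
    (Nat.dvd_factorial hd hdk.le).trans (hdvd.trans (Dvd.intro_left _ rfl))
  have hKm : (2 * m).leastNondivisor ≤ m - k := by
    -- If `m - k` divided `2 * m`, it would divide `2 * k`, but `m - k ≥ 3 * k`.
    refine Nat.leastNondivisor_le (by omega) fun h => ?_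
    have h' := Nat.dvd_sub h (Dvd.intro_left 2 rfl : m - k ∣ 2 * (m - k))
    have := Nat.le_of_dvd (by omega) h'
    omega
  -- With `2 ^ m` vertices the label length is exactly `m`.
  have hpad : (⟦ofRel r (2 ^ m)⟧ : UnlabeledGraph) ∈ innerProductClass := by
    refine ⟨⟨_, rfl, fun u => innerProductLabel r k m u, fun u => ?_, fun u v => ?_⟩,
      _, rfl, fun u v => hsymm u v, fun u => hirr u⟩
    · simp [ofRel, innerProductLabel, Nat.clog_pow]
    · exact (innerProductLabel_mem_decoder hr hkK (by omega) u v).symm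
  have hle : k ≤ 2 ^ m := by have := Nat.lt_two_pow_self (n := m); omega
  exact hD _ _ ⟨ofRel r k, ofRel r (2 ^ m), rfl, rfl, ⟨⟨Fin.castLEEmb hle, Iff.rfl⟩⟩⟩ (hsub hpad)

/-! ### Counting graphs -/

/-- The adjacency relation of the bipartite graph with parts of size `a` and biadjacency matrix `f`. -/
def bipartiteRel {a : ℕ} (f : Fin a → Fin a → Bool) (u v : ℕ) : Prop :=
  ∃ i j, f i j = true ∧ (u = i ∧ v = a + j ∨ v = i ∧ u = a + j)

namespace bipartiteRel

variable {a : ℕ} (f : Fin a → Fin a → Bool)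

theorem lt {u v : ℕ} (h : bipartiteRel f u v) : u < 2 * a ∧ v < 2 * a := by
  obtain ⟨i, j, -, h⟩ := h; omega

theorem symm {u v : ℕ} (h : bipartiteRel f u v) : bipartiteRel f v u := by
  obtain ⟨i, j, hf, h⟩ := h; exact ⟨i, j, hf, h.symm⟩

theorem irrefl (u : ℕ) : ¬ bipartiteRel f u u := by
  rintro ⟨i, j, -, h⟩; omega

theorem iff_apply (i j : Fin a) : bipartiteRel f i (a + j) ↔ f i j = true := by
  constructor
  · rintro ⟨i', j', hf, h⟩
    obtain rfl : i = i' := by omega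
    obtain rfl : j = j' := by omega
    exact hf
  · exact fun h => ⟨i, j, h, .inl ⟨rfl, rfl⟩⟩

theorem ext_of_forall {f g : Fin a → Fin a → Bool}
    (h : ∀ u v : Fin (2 * a), bipartiteRel f u v ↔ bipartiteRel g u v) : f = g := by
  funext i j
  have := h ⟨i, by omega⟩ ⟨a + j, by omega⟩
  simpa only [iff_apply, Bool.coe_iff_coe] using this

end bipartiteRel

/-- An isomorphism onto the graph of `f₀` is a permutation of the vertices, and together with `f₀`
it determines `f`. So the fiber injects into the permutations of `2 * a` points. -/
theorem card_fiber_le {a : ℕ} (f₀ : Fin a → Fin a → Bool)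
    (s : Finset (Fin a → Fin a → Bool))
    (hs : ∀ f ∈ s, (⟦ofRel (bipartiteRel f) (2 * a)⟧ : UnlabeledGraph) =
      ⟦ofRel (bipartiteRel f₀) (2 * a)⟧) : s.card ≤ (2 * a).factorial := by
  have hiso : ∀ f : s, ∃ e : Equiv.Perm (Fin (2 * a)),
      ∀ u v, bipartiteRel f₀ (e u) (e v) ↔ bipartiteRel f.1 u v := fun f => by
    obtain ⟨e⟩ := Quotient.exact (hs f.1 f.2)
    exact ⟨e.toEquiv, fun u v => e.map_rel_iff⟩
  choose e he using hiso
  have hinj : Function.Injective e := fun f g h =>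
    Subtype.ext (bipartiteRel.ext_of_forall fun u v => by rw [← he, ← he, h])
  have := Fintype.card_le_of_injective e hinj
  rwa [Fintype.card_coe, Fintype.card_perm, Fintype.card_fin] at this

/-- A class that contains all bipartite graphs has at least `2 ^ a² / (2 a)!` graphs on `2 a` vertices. -/
theorem two_pow_le_of_encard_le {D : GraphClass} {a b : ℕ}
    (hD : ∀ f : Fin a → Fin a → Bool, (⟦ofRel (bipartiteRel f) (2 * a)⟧ : UnlabeledGraph) ∈ D)
    (hb : {g ∈ D | g.order = 2 * a}.encard ≤ (b : ℕ∞)) :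
    2 ^ (a * a) ≤ (2 * a).factorial * b := by
  classical
  let F : (Fin a → Fin a → Bool) → UnlabeledGraph := fun f => ⟦ofRel (bipartiteRel f) (2 * a)⟧
  have h₁ : (Finset.univ.image F).card ≤ b := by
    have hsub : (↑(Finset.univ.image F) : Set UnlabeledGraph) ⊆ {g ∈ D | g.order = 2 * a} := by
      intro g hg
      obtain ⟨f, -, rfl⟩ := Finset.mem_image.1 (Finset.mem_coe.1 hg)
      exact ⟨hD f, rfl⟩
    have := (Set.encard_le_encard hsub).trans hb
    rw [Set.encard_coe_eq_coe_finsetCard] at this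
    exact_mod_cast this
  have h₂ := Finset.card_le_mul_card_image (f := F) Finset.univ (2 * a).factorial fun g hg => by
    obtain ⟨f₀, -, rfl⟩ := Finset.mem_image.1 hg
    exact card_fiber_le f₀ _ fun f hf => (Finset.mem_filter.1 hf).2
  have h₃ : (Finset.univ : Finset (Fin a → Fin a → Bool)).card = 2 ^ (a * a) := by
    simp [pow_mul]
  rw [h₃] at h₂
  exact h₂.trans (Nat.mul_le_mul_left _ h₁)

theorem exists_factorial_mul_pow_lt (c n₀ : ℕ) :
    ∃ a, 0 < a ∧ n₀ ≤ 2 * a ∧ (2 * a).factorial * (2 * a) ^ (c * (2 * a)) < 2 ^ (a * a) := by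
  have hlim := tendsto_pow_const_div_const_pow_of_one_lt 1 (one_lt_two : (1 : ℝ) < 2)
  -- With `a = 2 ^ t` and `(2 * a)! ≤ (2 * a) ^ (2 * a)`, the left side is at most `2` to the power
  -- `(t + 1) * (2 * (c + 1)) * a`, so it suffices that the factor before `a` is less than `a`.
  obtain ⟨t, ht₀, ht⟩ : ∃ t : ℕ, n₀ ≤ t ∧ (t + 1) * (2 * (c + 1)) < 2 ^ t := by
    have h := (hlim.eventually (gt_mem_nhds (show (0 : ℝ) < 1 / (4 * (c + 1)) by positivity))).and
      (Filter.eventually_ge_atTop (max n₀ 1))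
    -- The constant `4` instead of `2` absorbs `t + 1 ≤ 2 * t`.
    obtain ⟨t, ht, ht'⟩ := h.exists
    refine ⟨t, le_of_max_le_left ht', ?_⟩
    rw [div_lt_div_iff₀ (by positivity) (by positivity), pow_one, one_mul] at ht
    have ht'' : t * (4 * (c + 1)) < 2 ^ t := by exact_mod_cast ht
    have : 1 ≤ t := le_of_max_le_right ht'
    nlinarith
  have hlt := Nat.lt_two_pow_self (n := t)
  refine ⟨2 ^ t, by positivity, by omega, ?_⟩
  have hpow : 2 * 2 ^ t = 2 ^ (t + 1) := by ring
  calc (2 * 2 ^ t).factorial * (2 * 2 ^ t) ^ (c * (2 * 2 ^ t))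
      ≤ (2 * 2 ^ t) ^ (2 * 2 ^ t) * (2 * 2 ^ t) ^ (c * (2 * 2 ^ t)) :=
        Nat.mul_le_mul_right _ (Nat.factorial_le_pow _)
    _ = 2 ^ ((t + 1) * (2 * (c + 1)) * 2 ^ t) := by
        rw [← pow_add, hpow, ← pow_mul, ← hpow]; congr 1; ring
    _ < 2 ^ (2 ^ t * 2 ^ t) :=
        Nat.pow_lt_pow_right one_lt_two (Nat.mul_lt_mul_of_pos_right ht (by positivity))

theorem innerProductClass_not_mem_subsetClosure :
    innerProductClass ∉ GraphClass.subsetClosure {C : GraphClass | C.IsSmall ∧ C.IsHereditary} := by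
  rintro ⟨D, ⟨⟨c, hsmall⟩, hher⟩, hsub⟩
  obtain ⟨n₀, hn₀⟩ := Filter.eventually_atTop.1 hsmall
  obtain ⟨a, ha, han, hlt⟩ := exists_factorial_mul_pow_lt c n₀
  exact hlt.not_ge (two_pow_le_of_encard_le (fun f => hher.mk_ofRel_mem hsub (by omega)
    (fun _ _ => bipartiteRel.lt f) (fun _ _ => bipartiteRel.symm f) (bipartiteRel.irrefl f))
    (hn₀ _ han))

theorem mainTheorem2 :
    ¬ (GClasses ACZero ⊆
        GraphClass.subsetClosure {C : GraphClass | C.IsSmall ∧ C.IsHereditary}) ∧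
    ¬ ({C ∈ GClasses ACZero | C.IsUndirected} ⊆
        GraphClass.subsetClosure {C : GraphClass | C.IsSmall ∧ C.IsHereditary}) :=
  ⟨fun h => innerProductClass_not_mem_subsetClosure (h innerProductClass_mem.1),
    fun h => innerProductClass_not_mem_subsetClosure (h innerProductClass_mem)⟩
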